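/- Let $f\in C^2(0,\infty)$ be real-valued with $f''>0$ on $(0,\infty)$, and suppose that $$f''(x)=c+\int_{[0,\infty)}\frac{t+1}{t+x}\,d\mu(t),\qquad x>0,$$ where $c\ge 0$ and $\mu$ is a finite positive measure on $[0,\infty)$. Let $f'^{[1]}(s,t)=\frac{f'(s)-f'(t)}{s-t}$ for $s\neq t$ and $f'^{[1]}(s,s)=f''(s)$. Let $H$ be a finite-dimensional complex Hilbert space and write $\langle X,Y\rangle=\mathrm{Tr}(XY^*)$ on $B(H)$. For $F:(0,\infty)^2\to(0,\infty)$ and positive invertible $A,B\in B(H)$ with spectral decompositions $A=\sum_j\lambda_jE_j^A$, $B=\sum_k\mu_kE_k^B$, put $$Q_F^{A,B}(X)=\sum_{j,k}F(\lambda_j,\mu_k)\,E_j^A X E_k^B .$$ Let $\phi:B(H)\to B(H)$ be a unital completely positive trace preserving linear map. Then for all positive invertible $A,B\in B(H)$ and all $X\in B(H)$, $$\left\langle \phi(X),Q^{\phi(A),\phi(B)}_{f'^{[1]}}(\phi(X))\right\rangle\le\left\langle X,Q^{A,B}_{f'^{[1]}}(X)\right\rangle .$$ The inequality remains true for all positive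 $A,B\in B(H)$, not necessarily invertible, when both sides are read as elements of $[0,\infty]$: $\langle X,Q^{A,B}_{F}(X)\rangle$ then stands for $\sum_{j,k}F(\lambda_j,\mu_k)\,\mathrm{Tr}\big((E_j^AXE_k^B)(E_j^AXE_k^B)^*\big)$, where $F=f'^{[1]}$ is extended to $[0,\infty)^2$ by $F(s,t)=\liminf_{(s',t')\to(s,t),\ s',t'>0}F(s',t')\in[0,\infty]$, and $\infty\cdot 0=0$. -/

import Mathlib

open scoped ComplexOrder NNReal ENNReal

noncomputable section

/-- The Hilbert-Schmidt inner product `⟨X, Y⟩ = Tr (X Y*)` on `B(H)`. -/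
def hsInner {H : Type*} [NormedAddCommGroup H] [InnerProductSpace ℂ H] [CompleteSpace H]
    (X Y : H →L[ℂ] H) : ℂ :=
  LinearMap.trace ℂ H ((X * star Y : H →L[ℂ] H) : H →ₗ[ℂ] H)

/-- `φ` is unital and trace preserving. Together with complete positivity, which is
part of the type of `φ`, this says that `φ` is a UCPTP map over `B(H)`. -/
structure IsUCPTP {H : Type*} [NormedAddCommGroup H] [InnerProductSpace ℂ H] [CompleteSpace H]
    (φ : CompletelyPositiveMap (H →L[ℂ] H) (H →L[ℂ] H)) : Prop where
  unital : φ 1 = 1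
  trace_preserving : ∀ X : H →L[ℂ] H,
    LinearMap.trace ℂ H (φ X : H →ₗ[ℂ] H) = LinearMap.trace ℂ H (X : H →ₗ[ℂ] H)

/-- The spectral projection of `A` at the eigenvalue `z`: the orthogonal projection
onto the eigenspace. -/
def eigenProj {H : Type*} [NormedAddCommGroup H] [InnerProductSpace ℂ H] [FiniteDimensional ℂ H]
    (A : H →L[ℂ] H) (z : ℂ) : H →L[ℂ] H :=
  (Module.End.eigenspace (A : H →ₗ[ℂ] H) z).starProjection

/-- The double-operator map `Q_F^{A,B}(X) = ∑_{j,k} F(λ_j, μ_k) E_j^A X E_k^B`, where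
`A = ∑ λ_j E_j^A` and `B = ∑ μ_k E_k^B` are the spectral decompositions, indexed by the
distinct eigenvalues. The operators `A` and `B` to which it is applied are self-adjoint, so
their eigenvalues are real and equal to their real parts. -/
def doubleOp {H : Type*} [NormedAddCommGroup H] [InnerProductSpace ℂ H] [FiniteDimensional ℂ H]
    (F : ℝ → ℝ → ℝ) (A B X : H →L[ℂ] H) : H →L[ℂ] H :=
  ∑ j : Module.End.Eigenvalues (A : H →ₗ[ℂ] H), ∑ k : Module.End.Eigenvalues (B : H →ₗ[ℂ] H),
    (F (j : ℂ).re (k : ℂ).re : ℂ) • (eigenProj A (j : ℂ) * X * eigenProj B (k : ℂ))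

/-- The difference quotient `g^{[1]}`. -/
def diffQuot (g : ℝ → ℝ) (s t : ℝ) : ℝ :=
  if s = t then deriv g s else (g s - g t) / (s - t)

/-- The extension of a nonnegative function `F` on `(0,∞)²` to `[0,∞)²` by lower limits, with
values in `[0,∞]`. It agrees with `F` wherever `F` is continuous, and is the limit of `F` at
a boundary point whenever that limit exists in `[0,∞]`. -/
def boundaryExt (F : ℝ → ℝ → ℝ) (s t : ℝ) : ℝ≥0∞ :=
  Filter.liminf (fun p : ℝ × ℝ => ENNReal.ofReal (F p.1 p.2))
    (nhdsWithin (s, t) (Set.Ioi 0 ×ˢ Set.Ioi 0))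

/-- The quadratic form `⟨X, Q_F^{A,B}(X)⟩ = ∑_{j,k} F(λ_j, μ_k) ‖E_j^A X E_k^B‖₂²` for positive
`A`, `B` that need not be invertible, with values in `[0,∞]`, where `F` is extended to
`[0,∞)²` by `boundaryExt` (and `∞ * 0 = 0`). -/
def doubleOpForm {H : Type*} [NormedAddCommGroup H] [InnerProductSpace ℂ H] [CompleteSpace H]
    [FiniteDimensional ℂ H] (F : ℝ → ℝ → ℝ) (A B X : H →L[ℂ] H) : ℝ≥0∞ :=
  ∑ j : Module.End.Eigenvalues (A : H →ₗ[ℂ] H), ∑ k : Module.End.Eigenvalues (B : H →ₗ[ℂ] H),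
    boundaryExt F (j : ℂ).re (k : ℂ).re *
      ENNReal.ofReal (hsInner (eigenProj A (j : ℂ) * X * eigenProj B (k : ℂ))
        (eigenProj A (j : ℂ) * X * eigenProj B (k : ℂ))).re

end

/-!
The argument writes `f'^{[1]}` as a positive superposition of kernels `(r + a s + b t)⁻¹` and proves
the inequality for each of them.

For such a kernel, `Q^{A,B}` is the inverse of `M = r + a L_A + b R_B`, where `L_A` and `R_B` are
left and right multiplications. If `A ≥ 0`, the block matrix `[[A, A Z], [Z* A, Z* A Z]]` is
positive, and two-positivity together with trace preservation gives
`2 Re⟨φ(A Z), Y⟩ ≤ ⟨φ(A) Y, Y⟩ + ⟨A Z, Z⟩` for all `Y` and `Z` (`two_positivity_left`); there is an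
analogue for `R_B` (`two_positivity_right`), and the case `A = 1` covers the scalar term. With
`M Z = X` and `M_φ Y = φ(X)` a combination of the three inequalities is exactly
`⟨φ(X), M_φ⁻¹ φ(X)⟩ ≤ ⟨X, M⁻¹ X⟩` (`spectralForm_resolvent_le`). The adjoint of `φ` is not needed.

The difference quotient is `f'^{[1]}(s,t) = ∫₀¹ f''(u s + (1 - u) t) du`, and the representation of
`f''` turns each `f''(u s + (1 - u) t)` into a constant plus an integral of kernels as above; two
successive integrations of the inequality give `spectralForm_diffQuot_le`.

For operators that need not be invertible, the kernel is shifted by `ε > 0` in both variables. Since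
`f''` is decreasing, `f'^{[1]}` is antitone in both variables, so its extension by lower limits is
the limit of the shifted kernels as `ε ↓ 0` (`tendsto_boundaryExt`), and the inequality passes to
the limit.
-/

open Module.End (Eigenvalues)
open MeasureTheory Set Filter Topology

/-! ### Spectral projections -/

section

variable {H : Type*} [NormedAddCommGroup H] [InnerProductSpace ℂ H]
  [FiniteDimensional ℂ H]

/-- The spectral projections of a self-adjoint operator resolve the identity. -/
theorem sum_eigenProj {A : H →L[ℂ] H} (hA : (A : H →ₗ[ℂ] H).IsSymmetric) :
    ∑ j : Module.End.Eigenvalues (A : H →ₗ[ℂ] H), eigenProj A (j : ℂ) = 1 := by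
  ext x
  have h := hA.orthogonalFamily_eigenspaces'.sum_projection_of_mem_iSup x (by
    rw [Submodule.orthogonal_eq_bot_iff.mp hA.orthogonalComplement_iSup_eigenspaces_eq_bot']
    trivial)
  simpa [eigenProj, sum_apply] using h

theorem eigenProj_mul_self (A : H →L[ℂ] H) (z : ℂ) :
    eigenProj A z * eigenProj A z = eigenProj A z :=
  (Submodule.isIdempotentElem_starProjection _).eq

theorem mul_eigenProj (A : H →L[ℂ] H) (z : ℂ) : A * eigenProj A z = z • eigenProj A z := by
  ext x
  exact Module.End.mem_eigenspace_iff.mp (Submodule.starProjection_apply_mem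
    (Module.End.eigenspace (A : H →ₗ[ℂ] H) z) x)

end

section

variable {H : Type*} [NormedAddCommGroup H] [InnerProductSpace ℂ H]

/-- A scalar lower bound `m ≤ A` bounds the eigenvalues of `A` from below by `m`. -/
theorem le_re_eigenvalue {A : H →L[ℂ] H} {m : ℝ}
    (h : algebraMap ℝ (H →L[ℂ] H) m ≤ A) (j : Eigenvalues (A : H →ₗ[ℂ] H)) :
    m ≤ (j : ℂ).re := by
  have hj : Module.End.HasEigenvalue (A : H →ₗ[ℂ] H) (j : ℂ) := j.property
  obtain ⟨v, hv⟩ := hj.exists_hasEigenvector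
  have h0 : 0 < ‖v‖ ^ 2 := by have := hv.2; positivity
  have h1 := (ContinuousLinearMap.le_def _ _).mp h |>.re_inner_nonneg_right v
  have h2 : A v = (j : ℂ) • v := hv.apply_eq_smul
  have h3 : (algebraMap ℝ (H →L[ℂ] H) m) v = (m : ℂ) • v := by
    simp [Algebra.algebraMap_eq_smul_one]
  rw [sub_apply, h2, h3, ← sub_smul, inner_smul_right,
    inner_self_eq_norm_sq_to_K] at h1
  have h4 : 0 ≤ ((j : ℂ).re - m) * ‖v‖ ^ 2 := by
    simpa [← Complex.ofReal_pow] using h1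
  nlinarith [nonneg_of_mul_nonneg_left h4 h0]

theorem isSymmetric_of_nonneg {A : H →L[ℂ] H} (hA : 0 ≤ A) : (A : H →ₗ[ℂ] H).IsSymmetric :=
  ((ContinuousLinearMap.nonneg_iff_isPositive A).mp hA).isSymmetric

end

section

variable {H : Type*} [NormedAddCommGroup H] [InnerProductSpace ℂ H]
  [CompleteSpace H]

theorem exists_pos_algebraMap_le {A : H →L[ℂ] H} (hA : IsStrictlyPositive A) :
    ∃ m : ℝ, 0 < m ∧ algebraMap ℝ (H →L[ℂ] H) m ≤ A := by
  rcases subsingleton_or_nontrivial (H →L[ℂ] H) with h | h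
  · exact ⟨1, one_pos, (Subsingleton.elim _ _).le⟩
  · exact (CFC.exists_pos_algebraMap_le_iff (IsSelfAdjoint.of_nonneg hA.nonneg)).mpr
      fun x hx => hA.spectrum_pos hx

end

section

variable {H : Type*} [NormedAddCommGroup H] [InnerProductSpace ℂ H]
  [CompleteSpace H] [FiniteDimensional ℂ H]

theorem star_eigenProj (A : H →L[ℂ] H) (z : ℂ) : star (eigenProj A z) = eigenProj A z :=
  (isSelfAdjoint_starProjection _).star_eq

theorem eigenProj_mul {A : H →L[ℂ] H} (hA : 0 ≤ A) (j : Eigenvalues (A : H →ₗ[ℂ] H)) :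
    eigenProj A j * A = (j : ℂ) • eigenProj A j := by
  have h := congrArg star (mul_eigenProj A (j : ℂ))
  have hj : star (j : ℂ) = j := (isSymmetric_of_nonneg hA).conj_eigenvalue_eq_self j.property
  rwa [star_mul, star_smul, star_eigenProj, hj, (IsSelfAdjoint.of_nonneg hA).star_eq] at h

end

/-! ### Traces and the Hilbert-Schmidt inner product -/

section

variable {H : Type*} [NormedAddCommGroup H] [InnerProductSpace ℂ H]

theorem trace_mul_comm_clm (S T : H →L[ℂ] H) :
    LinearMap.trace ℂ H ((S * T : H →L[ℂ] H) : H →ₗ[ℂ] H) =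
      LinearMap.trace ℂ H ((T * S : H →L[ℂ] H) : H →ₗ[ℂ] H) :=
  LinearMap.trace_mul_comm ℂ (S : H →ₗ[ℂ] H) (T : H →ₗ[ℂ] H)

end

section

variable {H : Type*} [NormedAddCommGroup H] [InnerProductSpace ℂ H]
  [CompleteSpace H]

theorem hsInner_add_left (X Y Z : H →L[ℂ] H) :
    hsInner (X + Y) Z = hsInner X Z + hsInner Y Z := by
  simp [hsInner, add_mul]

theorem hsInner_smul_left (a : ℂ) (X Y : H →L[ℂ] H) :
    hsInner (a • X) Y = a * hsInner X Y := by
  simp [hsInner]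

theorem hsInner_smul_right (a : ℝ) (X Y : H →L[ℂ] H) :
    hsInner X ((a : ℂ) • Y) = a * hsInner X Y := by
  simp [hsInner]

theorem hsInner_sum_right {ι : Type*} (s : Finset ι) (X : H →L[ℂ] H) (Y : ι → H →L[ℂ] H) :
    hsInner X (∑ i ∈ s, Y i) = ∑ i ∈ s, hsInner X (Y i) := by
  simp only [hsInner, star_sum, Finset.mul_sum]
  simp

end

section

variable {H : Type*} [NormedAddCommGroup H] [InnerProductSpace ℂ H]
  [CompleteSpace H] [FiniteDimensional ℂ H]

theorem trace_star_clm (S : H →L[ℂ] H) :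
    LinearMap.trace ℂ H ((star S : H →L[ℂ] H) : H →ₗ[ℂ] H) =
      star (LinearMap.trace ℂ H (S : H →ₗ[ℂ] H)) := by
  rw [LinearMap.trace_eq_sum_inner _ (stdOrthonormalBasis ℂ H),
    LinearMap.trace_eq_sum_inner _ (stdOrthonormalBasis ℂ H), star_sum]
  refine Finset.sum_congr rfl fun i _ => ?_
  simp [ContinuousLinearMap.star_eq_adjoint, ContinuousLinearMap.adjoint_inner_right]

theorem trace_star_mul_self_nonneg (S : H →L[ℂ] H) :
    0 ≤ LinearMap.trace ℂ H ((star S * S : H →L[ℂ] H) : H →ₗ[ℂ] H) := by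
  rw [LinearMap.trace_eq_sum_inner _ (stdOrthonormalBasis ℂ H)]
  refine Finset.sum_nonneg fun i _ => ?_
  have : inner ℂ ((stdOrthonormalBasis ℂ H) i) ((star S * S) ((stdOrthonormalBasis ℂ H) i)) =
      ((‖S ((stdOrthonormalBasis ℂ H) i)‖ ^ 2 : ℝ) : ℂ) := by
    simp [ContinuousLinearMap.star_eq_adjoint, ContinuousLinearMap.adjoint_inner_right]
  exact this ▸ Complex.zero_le_real.mpr (by positivity)

theorem hsInner_self_nonneg (X : H →L[ℂ] H) : 0 ≤ hsInner X X := by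
  unfold hsInner
  rw [trace_mul_comm_clm]
  exact trace_star_mul_self_nonneg X

theorem star_hsInner (X Y : H →L[ℂ] H) : star (hsInner X Y) = hsInner Y X := by
  simp only [hsInner, ← trace_star_clm, star_mul, star_star]

end

/-! ### Two-positivity -/

/-- With bundled C⋆-algebra instances this applies to `CStarMatrix`, where those needed by
`CStarAlgebra.nonneg_iff_eq_star_mul_self` are not found by unification. -/
theorem CStarAlgebra.exists_eq_star_mul_self {A : Type*} [CStarAlgebra A] [PartialOrder A]
    [StarOrderedRing A] {a : A} (ha : 0 ≤ a) : ∃ b, a = star b * b :=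
  CStarAlgebra.nonneg_iff_eq_star_mul_self.mp ha

section

variable {H : Type*} [NormedAddCommGroup H] [InnerProductSpace ℂ H]
  [CompleteSpace H]

/-- Since `[[A, A Z], [Z* A, Z* A Z]]` is a positive block matrix for `A ≥ 0`, so is its image under
`φ`. The conclusion records this positivity as a factorization `star N * N`, entry by entry. -/
theorem exists_block_factor (φ : CompletelyPositiveMap (H →L[ℂ] H) (H →L[ℂ] H))
    {A : H →L[ℂ] H} (hA : 0 ≤ A) (Z : H →L[ℂ] H) :
    ∃ N : CStarMatrix (Fin 2) (Fin 2) (H →L[ℂ] H),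
      φ A = ∑ k, star (N k 0) * N k 0 ∧ φ (A * Z) = ∑ k, star (N k 0) * N k 1 ∧
      φ (star Z * A) = ∑ k, star (N k 1) * N k 0 ∧
      φ (star Z * A * Z) = ∑ k, star (N k 1) * N k 1 := by
  obtain ⟨C, rfl⟩ := CStarAlgebra.nonneg_iff_eq_star_mul_self.mp hA
  -- With `A = C* C`, the block matrix is `V* V`.
  let V : CStarMatrix (Fin 2) (Fin 2) (H →L[ℂ] H) := CStarMatrix.ofMatrix !![C, C * Z; 0, 0]
  have h := φ.map_cstarMatrix_nonneg (star V * V) (star_mul_self_nonneg V)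
  obtain ⟨N, hN⟩ := CStarAlgebra.exists_eq_star_mul_self h
  have key (i j : Fin 2) : φ ((star V * V) i j) = ∑ k, star (N k i) * N k j := by
    have := congrFun (congrFun hN i) j
    simpa [CStarMatrix.mul_apply, CStarMatrix.star_apply] using this
  refine ⟨N, ?_, ?_, ?_, ?_⟩
  · rw [← key]; simp [CStarMatrix.mul_apply, CStarMatrix.star_apply, V]
  · rw [← key]; simp [CStarMatrix.mul_apply, CStarMatrix.star_apply, V, mul_assoc]
  · rw [← key]; simp [CStarMatrix.mul_apply, CStarMatrix.star_apply, V, mul_assoc]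
  · rw [← key]; simp [CStarMatrix.mul_apply, CStarMatrix.star_apply, V, mul_assoc]

theorem algebraMap_le_map {φ : CompletelyPositiveMap (H →L[ℂ] H) (H →L[ℂ] H)}
    (hφ : IsUCPTP φ) {A : H →L[ℂ] H} {m : ℝ} (hA : algebraMap ℝ (H →L[ℂ] H) m ≤ A) :
    algebraMap ℝ (H →L[ℂ] H) m ≤ φ A := by
  have h : φ (algebraMap ℝ (H →L[ℂ] H) m) = algebraMap ℝ (H →L[ℂ] H) m := by
    have e : algebraMap ℝ (H →L[ℂ] H) m = (m : ℂ) • (1 : H →L[ℂ] H) := by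
      rw [Algebra.algebraMap_eq_smul_one]; rfl
    rw [e, map_smul, hφ.unital]
  exact h ▸ OrderHomClass.mono φ hA

end

section

variable {H : Type*} [NormedAddCommGroup H] [InnerProductSpace ℂ H]
  [CompleteSpace H] [FiniteDimensional ℂ H]

/-- The trace of the block inequality given by `exists_block_factor`, compressed to the column
`(Y, -1)`. Trace preservation removes `φ` from the last term. -/
theorem two_positivity_trace {φ : CompletelyPositiveMap (H →L[ℂ] H) (H →L[ℂ] H)}
    (hφ : IsUCPTP φ) {A : H →L[ℂ] H} (hA : 0 ≤ A) (Y Z : H →L[ℂ] H) :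
    0 ≤ LinearMap.trace ℂ H ((star Y * φ A * Y : H →L[ℂ] H) : H →ₗ[ℂ] H)
      - LinearMap.trace ℂ H ((star Y * φ (A * Z) : H →L[ℂ] H) : H →ₗ[ℂ] H)
      - LinearMap.trace ℂ H ((φ (star Z * A) * Y : H →L[ℂ] H) : H →ₗ[ℂ] H)
      + LinearMap.trace ℂ H ((star Z * A * Z : H →L[ℂ] H) : H →ₗ[ℂ] H) := by
  obtain ⟨N, h1, h2, h3, h4⟩ := exists_block_factor φ hA Z
  rw [← hφ.trace_preserving (star Z * A * Z), h1, h2, h3, h4]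
  -- The four traces are those of `∑ k, T_k* T_k` with `T_k = N k 0 * Y - N k 1`.
  have := Finset.sum_nonneg fun k (_ : k ∈ Finset.univ) =>
    trace_star_mul_self_nonneg (N k 0 * Y - N k 1)
  convert this using 1
  rw [← map_sub, ← map_sub, ← map_add, ← map_sum]
  congr 1
  rw [← ContinuousLinearMap.toLinearMap_sub, ← ContinuousLinearMap.toLinearMap_sub,
    ← ContinuousLinearMap.toLinearMap_add, ← ContinuousLinearMap.toLinearMap_sum]
  congr 1
  simp only [Fin.sum_univ_two, star_sub, star_mul]
  noncomm_ring

/-- Schwarz-type inequality for left multiplications, phrased without the adjoint of `φ`. -/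
theorem two_positivity_left {φ : CompletelyPositiveMap (H →L[ℂ] H) (H →L[ℂ] H)}
    (hφ : IsUCPTP φ) {A : H →L[ℂ] H} (hA : 0 ≤ A) (Y Z : H →L[ℂ] H) :
    2 * (hsInner (φ (A * Z)) Y).re ≤ (hsInner (φ A * Y) Y).re + (hsInner (A * Z) Z).re := by
  obtain ⟨N, h1, h2, h3, h4⟩ := exists_block_factor φ hA Z
  have h5 : φ (star Z * A) = star (φ (A * Z)) := by simp [h2, h3]
  have h := (Complex.nonneg_iff.mp (two_positivity_trace hφ hA Y Z)).1
  have e1 := trace_mul_comm_clm (star Y) (φ A * Y)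
  have e2 := trace_mul_comm_clm (star Y) (φ (A * Z))
  have e3 : LinearMap.trace ℂ H ((φ (star Z * A) * Y : H →L[ℂ] H) : H →ₗ[ℂ] H) =
      star (hsInner (φ (A * Z)) Y) := by
    rw [star_hsInner, h5, trace_mul_comm_clm]; rfl
  have e4 := trace_mul_comm_clm (star Z) (A * Z)
  rw [mul_assoc, mul_assoc (star Z), e1, e2, e3, e4] at h
  change 0 ≤ (hsInner (φ A * Y) Y - hsInner (φ (A * Z)) Y - star (hsInner (φ (A * Z)) Y)
    + hsInner (A * Z) Z).re at h
  simp at h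
  linarith

/-- The counterpart of `two_positivity_left` for right multiplications. -/
theorem two_positivity_right {φ : CompletelyPositiveMap (H →L[ℂ] H) (H →L[ℂ] H)}
    (hφ : IsUCPTP φ) {A : H →L[ℂ] H} (hA : 0 ≤ A) (Y Z : H →L[ℂ] H) :
    2 * (hsInner (φ (Z * A)) Y).re ≤ (hsInner (Y * φ A) Y).re + (hsInner (Z * A) Z).re := by
  obtain ⟨N, h1, h2, h3, h4⟩ := exists_block_factor φ hA (star Z)
  rw [star_star] at h3
  have h5 : φ (A * star Z) = star (φ (Z * A)) := by simp [h2, h3]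
  have h := (Complex.nonneg_iff.mp (two_positivity_trace hφ hA (star Y) (star Z))).1
  have e2 : LinearMap.trace ℂ H ((Y * φ (A * star Z) : H →L[ℂ] H) : H →ₗ[ℂ] H) =
      star (hsInner (φ (Z * A)) Y) := by
    rw [star_hsInner, h5]; rfl
  rw [star_star, star_star, e2] at h
  change 0 ≤ (hsInner (Y * φ A) Y - star (hsInner (φ (Z * A)) Y) - hsInner (φ (Z * A)) Y
    + hsInner (Z * A) Z).re at h
  simp at h
  linarith

end

/-! ### Double-operator maps and their quadratic forms -/

section

variable {H : Type*} [NormedAddCommGroup H] [InnerProductSpace ℂ H]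
  [FiniteDimensional ℂ H]

theorem smul_doubleOp_add (a b d : ℝ) (F G K : ℝ → ℝ → ℝ) (A B X : H →L[ℂ] H) :
    (a : ℂ) • doubleOp F A B X + (b : ℂ) • doubleOp G A B X + (d : ℂ) • doubleOp K A B X =
      doubleOp (fun s t => a * F s t + b * G s t + d * K s t) A B X := by
  simp only [doubleOp, Finset.smul_sum, ← Finset.sum_add_distrib, smul_smul, ← add_smul]
  push_cast
  rfl

theorem mul_doubleOp {A : H →L[ℂ] H} (hA : 0 ≤ A) (F : ℝ → ℝ → ℝ) (B X : H →L[ℂ] H) :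
    A * doubleOp F A B X = doubleOp (fun s t => s * F s t) A B X := by
  simp only [doubleOp, Finset.mul_sum]
  refine Finset.sum_congr rfl fun j _ => Finset.sum_congr rfl fun k _ => ?_
  have hj : ((j : ℂ).re : ℂ) = j :=
    Complex.conj_eq_iff_re.mp ((isSymmetric_of_nonneg hA).conj_eigenvalue_eq_self j.property)
  rw [mul_smul_comm, ← mul_assoc, ← mul_assoc, mul_eigenProj, smul_mul_assoc, smul_mul_assoc,
    smul_smul]
  push_cast
  rw [hj, mul_comm]

theorem doubleOp_one {A B : H →L[ℂ] H} (hA : 0 ≤ A) (hB : 0 ≤ B) (X : H →L[ℂ] H) :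
    doubleOp (fun _ _ => 1) A B X = X := by
  simp only [doubleOp, Complex.ofReal_one, one_smul, ← Finset.mul_sum, ← Finset.sum_mul,
    sum_eigenProj (isSymmetric_of_nonneg hA), sum_eigenProj (isSymmetric_of_nonneg hB),
    one_mul, mul_one]

theorem doubleOp_congr {A B : H →L[ℂ] H} {m : ℝ} (hA : algebraMap ℝ (H →L[ℂ] H) m ≤ A)
    (hB : algebraMap ℝ (H →L[ℂ] H) m ≤ B) {F G : ℝ → ℝ → ℝ}
    (h : ∀ s t, m ≤ s → m ≤ t → F s t = G s t) (X : H →L[ℂ] H) :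
    doubleOp F A B X = doubleOp G A B X :=
  Finset.sum_congr rfl fun j _ => Finset.sum_congr rfl fun k _ => by
    rw [h _ _ (le_re_eigenvalue hA j) (le_re_eigenvalue hB k)]

end

section

variable {H : Type*} [NormedAddCommGroup H] [InnerProductSpace ℂ H]
  [CompleteSpace H] [FiniteDimensional ℂ H]

/-- The weight `‖E_z^A X E_w^B‖₂²` with which the pair `(z, w)` of eigenvalues enters the
quadratic form `⟨X, Q_F^{A,B}(X)⟩`. -/
noncomputable def eigenWeight (A B X : H →L[ℂ] H) (z w : ℂ) : ℝ :=
  (hsInner (eigenProj A z * X * eigenProj B w) (eigenProj A z * X * eigenProj B w)).re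

theorem eigenWeight_nonneg (A B X : H →L[ℂ] H) (z w : ℂ) : 0 ≤ eigenWeight A B X z w :=
  (Complex.nonneg_iff.mp (hsInner_self_nonneg _)).1

/-- The quadratic form `∑_{j,k} F(λ_j, μ_k) ‖E_j^A X E_k^B‖₂²` as a real number; the weights
are nonnegative, so it is monotone in `F`. -/
noncomputable def spectralForm (F : ℝ → ℝ → ℝ) (A B X : H →L[ℂ] H) : ℝ :=
  ∑ j : Eigenvalues (A : H →ₗ[ℂ] H), ∑ k : Eigenvalues (B : H →ₗ[ℂ] H),
    F (j : ℂ).re (k : ℂ).re * eigenWeight A B X j k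

theorem hsInner_eigenProj (A B X : H →L[ℂ] H) (z w : ℂ) :
    hsInner X (eigenProj A z * X * eigenProj B w) = eigenWeight A B X z w := by
  have h : hsInner X (eigenProj A z * X * eigenProj B w) =
      hsInner (eigenProj A z * X * eigenProj B w) (eigenProj A z * X * eigenProj B w) := by
    simp only [hsInner, star_mul, star_eigenProj, ← mul_assoc]
    rw [trace_mul_comm_clm _ (eigenProj A z), mul_assoc _ (eigenProj B w) (eigenProj B w),
      eigenProj_mul_self, trace_mul_comm_clm _ (eigenProj A z)]
    simp only [← mul_assoc, eigenProj_mul_self]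
  rw [h, eigenWeight]
  exact Complex.ext rfl (Complex.nonneg_iff.mp (hsInner_self_nonneg _)).2.symm

/-- In particular `⟨X, Q_F^{A,B}(X)⟩` is real. -/
theorem hsInner_doubleOp (F : ℝ → ℝ → ℝ) (A B X : H →L[ℂ] H) :
    hsInner X (doubleOp F A B X) = spectralForm F A B X := by
  simp only [doubleOp, hsInner_sum_right, hsInner_smul_right, hsInner_eigenProj, spectralForm]
  push_cast
  rfl

theorem doubleOp_mul {B : H →L[ℂ] H} (hB : 0 ≤ B) (F : ℝ → ℝ → ℝ) (A X : H →L[ℂ] H) :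
    doubleOp F A B X * B = doubleOp (fun s t => t * F s t) A B X := by
  simp only [doubleOp, Finset.sum_mul]
  refine Finset.sum_congr rfl fun j _ => Finset.sum_congr rfl fun k _ => ?_
  have hk : ((k : ℂ).re : ℂ) = k :=
    Complex.conj_eq_iff_re.mp ((isSymmetric_of_nonneg hB).conj_eigenvalue_eq_self k.property)
  rw [smul_mul_assoc, mul_assoc, eigenProj_mul hB, mul_smul_comm, smul_smul]
  push_cast
  rw [hk, mul_comm]

theorem spectralForm_congr {A B : H →L[ℂ] H} {m : ℝ} (hA : algebraMap ℝ (H →L[ℂ] H) m ≤ A)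
    (hB : algebraMap ℝ (H →L[ℂ] H) m ≤ B) {F G : ℝ → ℝ → ℝ}
    (h : ∀ s t, m ≤ s → m ≤ t → F s t = G s t) (X : H →L[ℂ] H) :
    spectralForm F A B X = spectralForm G A B X :=
  Finset.sum_congr rfl fun j _ => Finset.sum_congr rfl fun k _ => by
    rw [h _ _ (le_re_eigenvalue hA j) (le_re_eigenvalue hB k)]

theorem spectralForm_add (F G : ℝ → ℝ → ℝ) (A B X : H →L[ℂ] H) :
    spectralForm (fun s t => F s t + G s t) A B X =
      spectralForm F A B X + spectralForm G A B X := by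
  simp only [spectralForm, add_mul, Finset.sum_add_distrib]

theorem spectralForm_const_mul (a : ℝ) (F : ℝ → ℝ → ℝ) (A B X : H →L[ℂ] H) :
    spectralForm (fun s t => a * F s t) A B X = a * spectralForm F A B X := by
  simp only [spectralForm, Finset.mul_sum, mul_assoc]

/-- Integration of the kernel commutes with the quadratic form; integrability is only needed on
`[m,∞)²`, where all pairs of eigenvalues lie. -/
theorem integral_spectralForm {Ω : Type*} [MeasurableSpace Ω] {ν : MeasureTheory.Measure Ω}
    {A B : H →L[ℂ] H} {m : ℝ} (hA : algebraMap ℝ (H →L[ℂ] H) m ≤ A)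
    (hB : algebraMap ℝ (H →L[ℂ] H) m ≤ B) {F : Ω → ℝ → ℝ → ℝ}
    (hF : ∀ s t, m ≤ s → m ≤ t → MeasureTheory.Integrable (fun ω => F ω s t) ν)
    (X : H →L[ℂ] H) :
    MeasureTheory.Integrable (fun ω => spectralForm (F ω) A B X) ν ∧
    ∫ ω, spectralForm (F ω) A B X ∂ν = spectralForm (fun s t => ∫ ω, F ω s t ∂ν) A B X := by
  have hi (j : Eigenvalues (A : H →ₗ[ℂ] H)) (k : Eigenvalues (B : H →ₗ[ℂ] H)) :
      MeasureTheory.Integrable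
        (fun ω => F ω (j : ℂ).re (k : ℂ).re * eigenWeight A B X j k) ν :=
    (hF _ _ (le_re_eigenvalue hA j) (le_re_eigenvalue hB k)).mul_const _
  unfold spectralForm
  refine ⟨MeasureTheory.integrable_finsetSum _ fun j _ =>
    MeasureTheory.integrable_finsetSum _ fun k _ => hi j k, ?_⟩
  rw [MeasureTheory.integral_finsetSum _ fun j _ =>
    MeasureTheory.integrable_finsetSum _ fun k _ => hi j k]
  refine Finset.sum_congr rfl fun j _ => ?_
  rw [MeasureTheory.integral_finsetSum _ fun k _ => hi j k]
  exact Finset.sum_congr rfl fun k _ => MeasureTheory.integral_mul_const _ _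

/-- Monotonicity for the inverse of `M = r + a L_A + b R_B`, where `L_A` and `R_B` are the left and
right multiplications: with `M Z = X` and `M_φ Y = φ(X)`, the two-positivity inequalities add up to
`2 Re⟨φ(X), Y⟩ ≤ ⟨φ(X), Y⟩ + ⟨X, Z⟩`. -/
theorem spectralForm_resolvent_le {φ : CompletelyPositiveMap (H →L[ℂ] H) (H →L[ℂ] H)}
    (hφ : IsUCPTP φ) {A B : H →L[ℂ] H} {m : ℝ} (hm : 0 ≤ m)
    (hA : algebraMap ℝ (H →L[ℂ] H) m ≤ A) (hB : algebraMap ℝ (H →L[ℂ] H) m ≤ B)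
    {r a b : ℝ} (hr : 0 ≤ r) (ha : 0 ≤ a) (hb : 0 ≤ b)
    (hpos : ∀ s t, m ≤ s → m ≤ t → 0 < r + a * s + b * t) (X : H →L[ℂ] H) :
    spectralForm (fun s t => (r + a * s + b * t)⁻¹) (φ A) (φ B) (φ X) ≤
      spectralForm (fun s t => (r + a * s + b * t)⁻¹) A B X := by
  have hm' : (0 : H →L[ℂ] H) ≤ algebraMap ℝ (H →L[ℂ] H) m := by
    rw [Algebra.algebraMap_eq_smul_one]
    exact smul_nonneg hm zero_le_one
  -- The double-operator map of the inverse kernel inverts `r + a L_A + b R_B`.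
  have solve {A B : H →L[ℂ] H} (hA : algebraMap ℝ (H →L[ℂ] H) m ≤ A)
      (hB : algebraMap ℝ (H →L[ℂ] H) m ≤ B) (X : H →L[ℂ] H) :
      (r : ℂ) • doubleOp (fun s t => (r + a * s + b * t)⁻¹) A B X
      + (a : ℂ) • (A * doubleOp (fun s t => (r + a * s + b * t)⁻¹) A B X)
      + (b : ℂ) • (doubleOp (fun s t => (r + a * s + b * t)⁻¹) A B X * B) = X := by
    rw [mul_doubleOp (hm'.trans hA), doubleOp_mul (hm'.trans hB), smul_doubleOp_add,
      doubleOp_congr hA hB (G := fun _ _ => 1) _ X, doubleOp_one (hm'.trans hA) (hm'.trans hB)]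
    intro s t hs ht
    linear_combination mul_inv_cancel₀ (hpos s t hs ht).ne'
  have eZ := solve hA hB X
  have eY := solve (algebraMap_le_map hφ hA) (algebraMap_le_map hφ hB) (φ X)
  have hX := hsInner_doubleOp (fun s t => (r + a * s + b * t)⁻¹) A B X
  have hφX := hsInner_doubleOp (fun s t => (r + a * s + b * t)⁻¹) (φ A) (φ B) (φ X)
  set Z := doubleOp (fun s t => (r + a * s + b * t)⁻¹) A B X
  set Y := doubleOp (fun s t => (r + a * s + b * t)⁻¹) (φ A) (φ B) (φ X)
  have h1 := two_positivity_left hφ (zero_le_one' (H →L[ℂ] H)) Y Z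
  have h2 := two_positivity_left hφ (hm'.trans hA) Y Z
  have h3 := two_positivity_right hφ (hm'.trans hB) Y Z
  rw [hφ.unital, one_mul, one_mul] at h1
  have expand (P Q R W : H →L[ℂ] H) :
      (hsInner ((r : ℂ) • P + (a : ℂ) • Q + (b : ℂ) • R) W).re =
        r * (hsInner P W).re + a * (hsInner Q W).re + b * (hsInner R W).re := by
    simp only [hsInner_add_left, hsInner_smul_left, Complex.add_re, Complex.re_ofReal_mul]
  have e1 := expand Z (A * Z) (Z * B) Z
  have e2 := expand Y (φ A * Y) (Y * φ B) Y
  have e3 := expand (φ Z) (φ (A * Z)) (φ (Z * B)) Y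
  rw [← map_smul, ← map_smul, ← map_smul, ← map_add, ← map_add, eZ] at e3
  rw [eZ, hX, Complex.ofReal_re] at e1
  rw [eY, hφX, Complex.ofReal_re] at e2
  rw [hφX, Complex.ofReal_re] at e3
  nlinarith [mul_le_mul_of_nonneg_left h1 hr, mul_le_mul_of_nonneg_left h2 ha,
    mul_le_mul_of_nonneg_left h3 hb]

end

/-! ### Difference quotients -/

theorem integrable_add_one_div (μ : Measure ℝ≥0) [IsFiniteMeasure μ] {x : ℝ} (hx : 0 < x) :
    Integrable (fun t : ℝ≥0 => ((t : ℝ) + 1) / ((t : ℝ) + x)) μ := by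
  have hmeas : Measurable fun t : ℝ≥0 => ((t : ℝ) + 1) / ((t : ℝ) + x) := by fun_prop
  refine Integrable.of_bound hmeas.aestronglyMeasurable (1 + 1 / x) (ae_of_all _ fun t => ?_)
  have ht : (0 : ℝ) ≤ t := t.2
  rw [Real.norm_of_nonneg (by positivity), div_le_iff₀ (by positivity)]
  have h1 : 1 / x * x = 1 := by field_simp
  have h2 : 0 ≤ 1 / x * t := by positivity
  nlinarith

theorem antitoneOn_add_integral {c : ℝ} (μ : Measure ℝ≥0) [IsFiniteMeasure μ] {h : ℝ → ℝ}
    (hrep : ∀ x : ℝ, 0 < x → h x = c + ∫ t : ℝ≥0, ((t : ℝ) + 1) / ((t : ℝ) + x) ∂μ) :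
    AntitoneOn h (Ioi 0) := by
  intro x hx y hy hxy
  rw [hrep x hx, hrep y hy]
  gcongr
  · exact integrable_add_one_div μ hy
  · exact integrable_add_one_div μ hx
  · intro t
    have hx : 0 < x := hx
    dsimp only
    gcongr

theorem segment_pos {s t u : ℝ} (hs : 0 < s) (ht : 0 < t) (hu : u ∈ Icc (0 : ℝ) 1) :
    0 < u * s + (1 - u) * t := by
  obtain ⟨h0, h1⟩ := hu
  rcases h0.eq_or_lt with rfl | h0
  · simpa
  · have : 0 ≤ (1 - u) * t := mul_nonneg (by linarith) ht.le
    positivity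

theorem continuousOn_comp_segment {h : ℝ → ℝ} (hc : ContinuousOn h (Ioi 0)) {s t : ℝ}
    (hs : 0 < s) (ht : 0 < t) :
    ContinuousOn (fun u : ℝ => h (u * s + (1 - u) * t)) (Icc 0 1) :=
  hc.comp (by fun_prop) fun _ hu => segment_pos hs ht hu

/-- The difference quotient is the average of the derivative over the segment from `t` to `s`. -/
theorem diffQuot_eq_integral {g : ℝ → ℝ} (hd : ∀ x, 0 < x → DifferentiableAt ℝ g x)
    (hc : ContinuousOn (deriv g) (Ioi 0)) {s t : ℝ} (hs : 0 < s) (ht : 0 < t) :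
    diffQuot g s t = ∫ u in (0 : ℝ)..1, deriv g (u * s + (1 - u) * t) := by
  unfold diffQuot
  split_ifs with hst
  · subst hst
    have (u : ℝ) : u * s + (1 - u) * s = s := by ring
    simp [this]
  · have key : ∫ u in (0 : ℝ)..1, deriv g (u * s + (1 - u) * t) * (s - t) = g s - g t := by
      have := intervalIntegral.integral_eq_sub_of_hasDerivAt (a := (0 : ℝ)) (b := 1)
        (f := fun u => g (u * s + (1 - u) * t))
        (f' := fun u => deriv g (u * s + (1 - u) * t) * (s - t)) ?_ ?_
      · simpa using this
      · intro u hu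
        rw [uIcc_of_le zero_le_one] at hu
        have h1 : HasDerivAt (fun u : ℝ => u * s + (1 - u) * t) (s - t) u := by
          exact HasDerivAt.congr_deriv (((hasDerivAt_id u).mul_const s).add
            (((hasDerivAt_const u (1 : ℝ)).sub (hasDerivAt_id u)).mul_const t)) (by ring)
        exact (hd _ (segment_pos hs ht hu)).hasDerivAt.comp u h1
      · apply ContinuousOn.intervalIntegrable
        rw [uIcc_of_le zero_le_one]
        exact (continuousOn_comp_segment hc hs ht).mul continuousOn_const
    rw [intervalIntegral.integral_mul_const] at key
    rw [← key, mul_div_cancel_right₀ _ (sub_ne_zero.mpr hst)]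

theorem diffQuot_anti {g : ℝ → ℝ} (hd : ∀ x, 0 < x → DifferentiableAt ℝ g x)
    (hc : ContinuousOn (deriv g) (Ioi 0)) (hg : AntitoneOn (deriv g) (Ioi 0))
    {s t s' t' : ℝ} (hs : 0 < s) (ht : 0 < t) (hss : s ≤ s') (htt : t ≤ t') :
    diffQuot g s' t' ≤ diffQuot g s t := by
  have hs' := hs.trans_le hss
  have ht' := ht.trans_le htt
  rw [diffQuot_eq_integral hd hc hs ht, diffQuot_eq_integral hd hc hs' ht']
  have hint {s t : ℝ} (hs : 0 < s) (ht : 0 < t) :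
      IntervalIntegrable (fun u : ℝ => deriv g (u * s + (1 - u) * t)) volume 0 1 := by
    apply ContinuousOn.intervalIntegrable
    rw [uIcc_of_le zero_le_one]
    exact continuousOn_comp_segment hc hs ht
  refine intervalIntegral.integral_mono_on zero_le_one (hint hs' ht') (hint hs ht) fun u hu => ?_
  refine hg (segment_pos hs ht hu) (segment_pos hs' ht' hu) ?_
  have h0 := hu.1
  have h1 : 0 ≤ 1 - u := by linarith [hu.2]
  gcongr

/-! ### Monotonicity for difference quotients -/

section

variable {H : Type*} [NormedAddCommGroup H] [InnerProductSpace ℂ H]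
  [CompleteSpace H] [FiniteDimensional ℂ H]

/-- Monotonicity for the kernel `h(u s + (1 - u) t)`, shifted by `ε` in both variables. It is a
superposition, with nonnegative weights, of the kernels of `spectralForm_resolvent_le`. -/
theorem spectralForm_segment_le {φ : CompletelyPositiveMap (H →L[ℂ] H) (H →L[ℂ] H)}
    (hφ : IsUCPTP φ) {A B : H →L[ℂ] H} {m ε : ℝ} (hm : 0 ≤ m) (hε : 0 ≤ ε) (hmε : 0 < m + ε)
    (hA : algebraMap ℝ (H →L[ℂ] H) m ≤ A) (hB : algebraMap ℝ (H →L[ℂ] H) m ≤ B)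
    {c : ℝ} (hc : 0 ≤ c) (μ : Measure ℝ≥0) [IsFiniteMeasure μ] {h : ℝ → ℝ}
    (hrep : ∀ x : ℝ, 0 < x → h x = c + ∫ t : ℝ≥0, ((t : ℝ) + 1) / ((t : ℝ) + x) ∂μ)
    {u : ℝ} (hu : u ∈ Icc (0 : ℝ) 1) (X : H →L[ℂ] H) :
    spectralForm (fun s t => h (u * (s + ε) + (1 - u) * (t + ε))) (φ A) (φ B) (φ X) ≤
      spectralForm (fun s t => h (u * (s + ε) + (1 - u) * (t + ε))) A B X := by
  have hA' := algebraMap_le_map hφ hA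
  have hB' := algebraMap_le_map hφ hB
  have hu1 : 0 ≤ 1 - u := by linarith [hu.2]
  have hpos {s t : ℝ} (hs : m ≤ s) (ht : m ≤ t) : 0 < u * (s + ε) + (1 - u) * (t + ε) :=
    segment_pos (by linarith) (by linarith) hu
  have hint (s t : ℝ) (hs : m ≤ s) (ht : m ≤ t) :
      Integrable (fun τ : ℝ≥0 => ((τ : ℝ) + 1) * (τ + ε + u * s + (1 - u) * t)⁻¹) μ := by
    convert integrable_add_one_div μ (hpos hs ht) using 2 with τ
    rw [div_eq_mul_inv]
    ring_nf
  -- The constant `c` is written as a resolvent kernel too, with `r = 1` and `a = b = 0`.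
  have hh (s t : ℝ) (hs : m ≤ s) (ht : m ≤ t) : h (u * (s + ε) + (1 - u) * (t + ε)) =
      c * (1 + 0 * s + 0 * t)⁻¹
        + ∫ τ : ℝ≥0, ((τ : ℝ) + 1) * (τ + ε + u * s + (1 - u) * t)⁻¹ ∂μ := by
    rw [hrep _ (hpos hs ht)]
    congr 1
    · simp
    · congr 1 with τ
      rw [div_eq_mul_inv]
      ring_nf
  rw [spectralForm_congr hA hB hh, spectralForm_congr hA' hB' hh, spectralForm_add,
    spectralForm_add, spectralForm_const_mul, spectralForm_const_mul]
  obtain ⟨i1, e1⟩ := integral_spectralForm hA hB hint X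
  obtain ⟨i2, e2⟩ := integral_spectralForm hA' hB' hint (φ X)
  rw [← e1, ← e2]
  refine add_le_add (mul_le_mul_of_nonneg_left ?_ hc) (integral_mono i2 i1 fun τ => ?_)
  · exact spectralForm_resolvent_le hφ hm hA hB zero_le_one le_rfl le_rfl (by simp) X
  · have hτ : (0 : ℝ) ≤ τ := τ.2
    dsimp only
    rw [spectralForm_const_mul, spectralForm_const_mul]
    refine mul_le_mul_of_nonneg_left ?_ (by positivity)
    refine spectralForm_resolvent_le hφ hm hA hB (by positivity) hu.1 hu1 (fun s t hs ht => ?_) X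
    linarith [hpos hs ht]

/-- Monotonicity for the shifted difference quotient. The two cases of interest are `ε = 0` with
`m > 0`, and `m = 0` with `ε > 0`. -/
theorem spectralForm_diffQuot_le {φ : CompletelyPositiveMap (H →L[ℂ] H) (H →L[ℂ] H)}
    (hφ : IsUCPTP φ) {A B : H →L[ℂ] H} {m ε : ℝ} (hm : 0 ≤ m) (hε : 0 ≤ ε) (hmε : 0 < m + ε)
    (hA : algebraMap ℝ (H →L[ℂ] H) m ≤ A) (hB : algebraMap ℝ (H →L[ℂ] H) m ≤ B)
    {g : ℝ → ℝ} (hd : ∀ x, 0 < x → DifferentiableAt ℝ g x)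
    (hcont : ContinuousOn (deriv g) (Ioi 0))
    {c : ℝ} (hc : 0 ≤ c) (μ : Measure ℝ≥0) [IsFiniteMeasure μ]
    (hrep : ∀ x : ℝ, 0 < x →
      deriv g x = c + ∫ t : ℝ≥0, ((t : ℝ) + 1) / ((t : ℝ) + x) ∂μ) (X : H →L[ℂ] H) :
    spectralForm (fun s t => diffQuot g (s + ε) (t + ε)) (φ A) (φ B) (φ X) ≤
      spectralForm (fun s t => diffQuot g (s + ε) (t + ε)) A B X := by
  have hA' := algebraMap_le_map hφ hA
  have hB' := algebraMap_le_map hφ hB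
  have hint (s t : ℝ) (hs : m ≤ s) (ht : m ≤ t) :
      Integrable (fun u : ℝ => deriv g (u * (s + ε) + (1 - u) * (t + ε)))
        (volume.restrict (Icc 0 1)) :=
    (continuousOn_comp_segment hcont (by linarith) (by linarith)).integrableOn_Icc
  have hq (s t : ℝ) (hs : m ≤ s) (ht : m ≤ t) : diffQuot g (s + ε) (t + ε) =
      ∫ u in Icc (0 : ℝ) 1, deriv g (u * (s + ε) + (1 - u) * (t + ε)) := by
    rw [diffQuot_eq_integral hd hcont (by linarith) (by linarith),
      intervalIntegral.integral_of_le zero_le_one, integral_Icc_eq_integral_Ioc]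
  obtain ⟨i1, e1⟩ := integral_spectralForm hA hB hint X
  obtain ⟨i2, e2⟩ := integral_spectralForm hA' hB' hint (φ X)
  rw [spectralForm_congr hA hB hq, spectralForm_congr hA' hB' hq, ← e1, ← e2]
  exact setIntegral_mono_on i2 i1 measurableSet_Icc fun u hu =>
    spectralForm_segment_le hφ hm hε hmε hA hB hc μ hrep hu X

end

/-! ### Boundary values -/

/-- For an antitone kernel the lower limit defining `boundaryExt` is the limit along the diagonal
direction. -/
theorem tendsto_boundaryExt {F : ℝ → ℝ → ℝ}
    (hF : ∀ s t s' t', 0 < s → 0 < t → s ≤ s' → t ≤ t' → F s' t' ≤ F s t)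
    {s t : ℝ} (hs : 0 ≤ s) (ht : 0 ≤ t) :
    Tendsto (fun ε : ℝ => ENNReal.ofReal (F (s + ε) (t + ε))) (𝓝[>] 0)
      (𝓝 (boundaryExt F s t)) := by
  have hpath : Tendsto (fun ε : ℝ => (s + ε, t + ε)) (𝓝[>] 0) (𝓝[Ioi 0 ×ˢ Ioi 0] (s, t)) := by
    refine tendsto_nhdsWithin_iff.mpr ⟨?_, ?_⟩
    · have : Continuous fun ε : ℝ => (s + ε, t + ε) := by fun_prop
      simpa using (this.tendsto 0).mono_left nhdsWithin_le_nhds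
    · filter_upwards [self_mem_nhdsWithin] with ε hε
      have hε : 0 < ε := hε
      exact ⟨add_pos_of_nonneg_of_pos hs hε, add_pos_of_nonneg_of_pos ht hε⟩
  refine tendsto_of_le_liminf_of_limsup_le ?_ ?_
  · exact liminf_le_liminf_of_le hpath
  · refine limsup_le_of_le (h := ?_)
    filter_upwards [self_mem_nhdsWithin] with ε hε
    have hε : 0 < ε := hε
    refine le_liminf_of_le (h := ?_)
    have h1 : ∀ᶠ p : ℝ × ℝ in 𝓝 (s, t), p.1 < s + ε ∧ p.2 < t + ε :=
      (continuous_fst.tendsto (s, t) |>.eventually_lt_const (by simpa)).and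
        (continuous_snd.tendsto (s, t) |>.eventually_lt_const (by simpa))
    filter_upwards [nhdsWithin_le_nhds h1, self_mem_nhdsWithin] with p hp hp0
    exact ENNReal.ofReal_le_ofReal (hF _ _ _ _ hp0.1 hp0.2 hp.1.le hp.2.le)

section

variable {H : Type*} [NormedAddCommGroup H] [InnerProductSpace ℂ H]
  [CompleteSpace H] [FiniteDimensional ℂ H]

/-- The extended form is the limit of the forms of the shifted kernels, that is, of the forms at
`A + ε` and `B + ε`. -/
theorem tendsto_doubleOpForm {F : ℝ → ℝ → ℝ} (h0 : ∀ s t, 0 < s → 0 < t → 0 ≤ F s t)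
    (hF : ∀ s t s' t', 0 < s → 0 < t → s ≤ s' → t ≤ t' → F s' t' ≤ F s t)
    {A B : H →L[ℂ] H} (hA : algebraMap ℝ (H →L[ℂ] H) 0 ≤ A)
    (hB : algebraMap ℝ (H →L[ℂ] H) 0 ≤ B) (X : H →L[ℂ] H) :
    Tendsto (fun ε : ℝ => ENNReal.ofReal
        (spectralForm (fun s t => F (s + ε) (t + ε)) A B X)) (𝓝[>] 0)
      (𝓝 (doubleOpForm F A B X)) := by
  have h : Tendsto (fun ε : ℝ => ∑ j : Eigenvalues (A : H →ₗ[ℂ] H),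
      ∑ k : Eigenvalues (B : H →ₗ[ℂ] H), ENNReal.ofReal (F ((j : ℂ).re + ε) ((k : ℂ).re + ε)) *
        ENNReal.ofReal (eigenWeight A B X j k)) (𝓝[>] 0) (𝓝 (doubleOpForm F A B X)) :=
    tendsto_finsetSum _ fun j _ => tendsto_finsetSum _ fun k _ =>
      ENNReal.Tendsto.mul_const
        (tendsto_boundaryExt hF (le_re_eigenvalue hA j) (le_re_eigenvalue hB k))
        (Or.inr ENNReal.ofReal_ne_top)
  refine h.congr' ?_
  filter_upwards [self_mem_nhdsWithin] with ε hε
  have hε : 0 < ε := hε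
  have hpos (j : Eigenvalues (A : H →ₗ[ℂ] H)) (k : Eigenvalues (B : H →ₗ[ℂ] H)) :
      0 ≤ F ((j : ℂ).re + ε) ((k : ℂ).re + ε) :=
    h0 _ _ (by linarith [le_re_eigenvalue hA j]) (by linarith [le_re_eigenvalue hB k])
  have hpos' (j : Eigenvalues (A : H →ₗ[ℂ] H)) (k : Eigenvalues (B : H →ₗ[ℂ] H)) :
      0 ≤ F ((j : ℂ).re + ε) ((k : ℂ).re + ε) * eigenWeight A B X j k :=
    mul_nonneg (hpos j k) (eigenWeight_nonneg A B X j k)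
  unfold spectralForm
  rw [ENNReal.ofReal_sum_of_nonneg fun j _ => Finset.sum_nonneg fun k _ => hpos' j k]
  refine Finset.sum_congr rfl fun j _ => ?_
  rw [ENNReal.ofReal_sum_of_nonneg fun k _ => hpos' j k]
  exact Finset.sum_congr rfl fun k _ => (ENNReal.ofReal_mul (hpos j k)).symm

end

theorem theorem5p1 (f : ℝ → ℝ) (hf : ContDiffOn ℝ 2 f (Set.Ioi 0))
    (hpos : ∀ x : ℝ, 0 < x → 0 < deriv (deriv f) x)
    (c : ℝ) (hc : 0 ≤ c)
    (μ : MeasureTheory.Measure ℝ≥0) [MeasureTheory.IsFiniteMeasure μ]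
    (hrep : ∀ x : ℝ, 0 < x →
      deriv (deriv f) x = c + ∫ t : ℝ≥0, ((t : ℝ) + 1) / ((t : ℝ) + x) ∂μ)
    {H : Type*} [NormedAddCommGroup H] [InnerProductSpace ℂ H] [CompleteSpace H]
    [FiniteDimensional ℂ H]
    (φ : CompletelyPositiveMap (H →L[ℂ] H) (H →L[ℂ] H)) (hφ : IsUCPTP φ)
    (A B X : H →L[ℂ] H) :
    (IsStrictlyPositive A → IsStrictlyPositive B →
      hsInner (φ X) (doubleOp (diffQuot (deriv f)) (φ A) (φ B) (φ X)) ≤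
        hsInner X (doubleOp (diffQuot (deriv f)) A B X)) ∧
    (0 ≤ A → 0 ≤ B →
      doubleOpForm (diffQuot (deriv f)) (φ A) (φ B) (φ X) ≤
        doubleOpForm (diffQuot (deriv f)) A B X) := by
  have hf1 : ContDiffOn ℝ 1 (deriv f) (Ioi 0) := hf.deriv_of_isOpen isOpen_Ioi (by norm_num)
  have hd (x : ℝ) (hx : 0 < x) : DifferentiableAt ℝ (deriv f) x :=
    (hf1.differentiableOn (by norm_num)).differentiableAt (Ioi_mem_nhds hx)
  have hcont : ContinuousOn (deriv (deriv f)) (Ioi 0) :=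
    hf1.continuousOn_deriv_of_isOpen isOpen_Ioi le_rfl
  have hanti := antitoneOn_add_integral μ hrep
  refine ⟨fun hA hB => ?_, fun hA hB => ?_⟩
  · obtain ⟨a, ha, hA⟩ := exists_pos_algebraMap_le hA
    obtain ⟨b, hb, hB⟩ := exists_pos_algebraMap_le hB
    have hmono : Monotone (algebraMap ℝ (H →L[ℂ] H)) := algebraMap_mono _
    rw [hsInner_doubleOp, hsInner_doubleOp, Complex.real_le_real]
    have h := spectralForm_diffQuot_le (m := min a b) (ε := 0) hφ (by positivity) le_rfl
      (by positivity) ((hmono (min_le_left a b)).trans hA) ((hmono (min_le_right a b)).trans hB)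
      hd hcont hc μ hrep X
    simpa only [add_zero] using h
  · rw [← map_zero (algebraMap ℝ (H →L[ℂ] H))] at hA hB
    have hF (s t s' t' : ℝ) (hs : 0 < s) (ht : 0 < t) (hss : s ≤ s') (htt : t ≤ t') :=
      diffQuot_anti hd hcont hanti hs ht hss htt
    have h0 (s t : ℝ) (hs : 0 < s) (ht : 0 < t) : 0 ≤ diffQuot (deriv f) s t := by
      rw [diffQuot_eq_integral hd hcont hs ht]
      exact intervalIntegral.integral_nonneg zero_le_one fun u hu =>
        (hpos _ (segment_pos hs ht hu)).le
    refine le_of_tendsto_of_tendsto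
      (tendsto_doubleOpForm h0 hF (algebraMap_le_map hφ hA) (algebraMap_le_map hφ hB) (φ X))
      (tendsto_doubleOpForm h0 hF hA hB X) ?_
    filter_upwards [self_mem_nhdsWithin] with ε hε
    have hε : 0 < ε := hε
    exact ENNReal.ofReal_le_ofReal (spectralForm_diffQuot_le hφ le_rfl hε.le (by simpa)
      hA hB hd hcont hc μ hrep X)
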